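/- Let $n\ge 0$ be an integer. Let $\mathcal F^2(\mathbb C^n)$ be the Fock space of entire functions $f$ on $\mathbb C^n$ with $\|f\|^2=\pi^{-n}\int_{\mathbb C^n}|f(z)|^2e^{-|z|^2}\,d\nu_{2n}(z)<\infty$, where $\nu_m$ denotes Lebesgue measure on $\mathbb R^m$ and $\mathbb C^n=\mathbb R^n+i\mathbb R^n\simeq\mathbb R^{2n}$. A positive Borel measure $\mu$ on $\mathbb C^n$ is called a Fock–Carleson measure if there is a constant $\omega>0$ such that $\int_{\mathbb C^n}|f(w)|^2e^{-|w|^2}\,d\mu(w)\le\omega\|f\|^2$ for all $f\in\mathcal F^2(\mathbb C^n)$; a complex measure is called Fock–Carleson if its total variation is. For a (positive or complex) regular Borel measure $\varrho$ on $\mathbb R^n$ whose total variation $|\varrho|$ is locally finite, put $$\gamma_\varrho(x)=\Big(\frac2\pi\Big)^{n/2}\int_{\mathbb R^n}e^{-(x-\sqrt2\,y)^2}\,d\varrho(y),\qquad x\in\mathbb R^n,$$ where $(x-\sqrt2\,y)^2=\sum_{j}(x_j-\sqrt2\,y_j)^2$. We write $\gamma_\varrho\in L_\infty(\mathbb R^n)$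 if this integral converges absolutely for almost every $x$ and defines a measurable, essentially bounded function. Let $\varrho\otimes\nu_n$ be the product measure, regarded as a measure on $\mathbb C^n$ via $(x,y)\mapsto x+iy$; its total variation is $|\varrho|\otimes\nu_n$. (a) If $\varrho$ is a positive regular Borel measure on $\mathbb R^n$ (finite on compact sets), then $\gamma_\varrho\in L_\infty(\mathbb R^n)$ if and only if $\varrho\otimes\nu_n$ is a Fock–Carleson measure. (b) If $\varrho$ is a complex regular Borel measure on $\mathbb R^n$ with locally finite total variation and $\varrho\otimes\nu_n$ is a Fock–Carleson measure, then $\gamma_\varrho\in L_\infty(\mathbb R^n)$. If moreover $|\varrho|(\mathbb R^n)<\infty$ is assumed, then $\gamma_\varrho\in L_\infty(\mathbb R^n)$ if and only if $\varrho\otimes\nu_n$ is a Fock–Carleson measure. -/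

import Mathlib

open MeasureTheory

noncomputable section

/-- The standard Gaussian measure `dg_n(z) = π⁻ⁿ exp(-|z|²) dν_{2n}(z)` on `ℂⁿ`, where `volume` on
`Fin n → ℂ` is the Lebesgue measure `ν_{2n}` and `|z|² = ∑ j, |z_j|²`. -/
def fockGaussian (n : ℕ) : Measure (Fin n → ℂ) :=
  volume.withDensity fun z =>
    ENNReal.ofReal ((Real.pi ^ n)⁻¹ * Real.exp (-∑ j, ‖z j‖ ^ 2))

/-- `f` belongs to the Fock space: it is entire on `ℂⁿ` and square integrable with respect to the
Gaussian measure. -/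
def MemFock {n : ℕ} (f : (Fin n → ℂ) → ℂ) : Prop :=
  Differentiable ℂ f ∧ MemLp f 2 (fockGaussian n)

/-- A positive measure `μ` on `ℂⁿ` is a Fock–Carleson measure: there is `ω > 0` with
`∫ |f(w)|² exp(-|w|²) dμ(w) ≤ ω ‖f‖²` for all `f` in the Fock space (integrals in `[0, ∞]`). -/
def IsFockCarleson {n : ℕ} (μ : Measure (Fin n → ℂ)) : Prop :=
  ∃ ω : ℝ, 0 < ω ∧ ∀ f : (Fin n → ℂ) → ℂ, MemFock f →
    ∫⁻ w, ENNReal.ofReal (‖f w‖ ^ 2 * Real.exp (-∑ j, ‖w j‖ ^ 2)) ∂μ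
      ≤ ENNReal.ofReal ω * ∫⁻ w, ENNReal.ofReal (‖f w‖ ^ 2) ∂(fockGaussian n)

/-- The measure `ϱ ⊗ ν_n` on `ℂⁿ = ℝⁿ + iℝⁿ`, with `ν_n` the Lebesgue measure: the image of the
product measure under `(x, y) ↦ x + iy`. -/
def tensorLebesgue {n : ℕ} (ϱ : Measure (Fin n → ℝ)) : Measure (Fin n → ℂ) :=
  (ϱ.prod volume).map fun (p : (Fin n → ℝ) × (Fin n → ℝ)) j => (p.1 j : ℂ) + (p.2 j : ℂ) * Complex.I

/-- A complex regular Borel measure on `ℝⁿ` with locally finite total variation, given by its polar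
decomposition `dϱ = h d|ϱ|`, `|h| = 1`. -/
structure ComplexRadonMeasure (n : ℕ) where
  /-- the total variation `|ϱ|` -/
  variation : Measure (Fin n → ℝ)
  regular : variation.Regular
  /-- the density `h` of `ϱ` with respect to `|ϱ|` -/
  phase : (Fin n → ℝ) → ℂ
  measurable_phase : Measurable phase
  norm_phase : ∀ y, ‖phase y‖ = 1

namespace ComplexRadonMeasure

/-- A positive regular Borel measure, viewed as a complex one. -/
def ofMeasure {n : ℕ} (ϱ : Measure (Fin n → ℝ)) [hϱ : ϱ.Regular] : ComplexRadonMeasure n where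
  variation := ϱ
  regular := hϱ
  phase := fun _ => 1
  measurable_phase := measurable_const
  norm_phase := fun _ => norm_one

/-- The function `y ↦ exp(-(x - √2 y)²) h(y)`, whose `|ϱ|`-integral is
`∫ exp(-(x - √2 y)²) dϱ(y)`; here `(x - √2 y)² = ∑ j, (x_j - √2 y_j)²`. -/
def spectralIntegrand {n : ℕ} (ϱ : ComplexRadonMeasure n) (x y : Fin n → ℝ) : ℂ :=
  (Real.exp (-∑ j, (x j - Real.sqrt 2 * y j) ^ 2) : ℂ) * ϱ.phase y

/-- The spectral function `γ_ϱ(x) = (2/π)^{n/2} ∫ exp(-(x - √2 y)²) dϱ(y)`. -/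
def spectralFunction {n : ℕ} (ϱ : ComplexRadonMeasure n) (x : Fin n → ℝ) : ℂ :=
  (((2 / Real.pi) ^ ((n : ℝ) / 2) : ℝ) : ℂ) * ∫ y, ϱ.spectralIntegrand x y ∂ϱ.variation

/-- `γ_ϱ ∈ L_∞(ℝⁿ)`: the integral defining `γ_ϱ(x)` converges absolutely for almost every `x`, and
`γ_ϱ` is measurable and essentially bounded for the Lebesgue measure. -/
def SpectralMemLinfty {n : ℕ} (ϱ : ComplexRadonMeasure n) : Prop :=
  (∀ᵐ x : Fin n → ℝ, Integrable (ϱ.spectralIntegrand x) ϱ.variation) ∧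
    MemLp ϱ.spectralFunction ⊤ volume

end ComplexRadonMeasure

end

/-!
Everything reduces to the `[0, ∞]`-valued Gaussian average
`G(x) = ∫ exp(-(x - √2 y)²) d|ϱ|(y)`: the measure `|ϱ| ⊗ ν_n` is Fock–Carleson if and only if `G` is
essentially bounded, and then `G` is bounded everywhere.

* If `|ϱ| ⊗ ν_n` is Fock–Carleson, the inequality is tested on the kernels
  `f(z) = exp(∑ j, a_j z_j)` with `a ∈ ℝⁿ`. Since `|f(z)|² exp(-|z|²) = exp(|a|²) exp(-|z - a|²)`, it
  bounds `∫ exp(-|a - y|²) d|ϱ|(y)` uniformly in `a`, hence also the smaller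
  `∫ exp(-2|a - y|²) d|ϱ|(y) = G(√2 a)` (`exists_gaussAverage_le_of_isFockCarleson`).
* Conversely, the mean value inequality for the entire function
  `z ↦ f(z)² exp(|w|² - 2 ⟨z, w⟩)` against the weight `exp(-3|z - w|²)` gives
  `|f(w)|² exp(-|w|²) ≤ C ∫ |f(z)|² exp(-|z|²) exp(-2|z - w|²) dν_{2n}(z)` (`enorm_sq_mul_exp_le`).
  Integrating in `w` against `|ϱ| ⊗ ν_n` and exchanging the integrals leaves
  `∫ exp(-2|z - w|²) d(|ϱ| ⊗ ν_n)(w)`, a constant multiple of `G(√2 Re z)`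
  (`isFockCarleson_of_gaussAverage_le`).

For positive `ϱ` the spectral function is `(2/π)^{n/2} G`. For complex `ϱ` it is dominated by
`(2/π)^{n/2} G`, and if `|ϱ|` is finite, then `G ≤ |ϱ|(ℝⁿ)`, so both sides of the equivalence hold.
-/

open ENNReal

noncomputable section

/-! ### Gaussian weights -/

/-- The Gaussian weight `exp(-b ∑ j, |v_j|²)` on `𝕜ⁿ`, as an extended nonnegative number. The norm
is written out, because `‖v‖` is the sup norm on `Fin n → 𝕜`. -/
def gaussWeight {n : ℕ} {𝕜 : Type*} [NormedAddCommGroup 𝕜] (b : ℝ) (v : Fin n → 𝕜) : ℝ≥0∞ :=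
  ENNReal.ofReal (Real.exp (-b * ∑ j, ‖v j‖ ^ 2))

section gaussWeight

variable {n : ℕ} {𝕜 : Type*} [NormedAddCommGroup 𝕜]

theorem continuous_gaussWeight (b : ℝ) :
    Continuous (gaussWeight b : (Fin n → 𝕜) → ℝ≥0∞) := by
  unfold gaussWeight
  exact ENNReal.continuous_ofReal.comp (by fun_prop)

theorem gaussWeight_ne_zero (b : ℝ) (v : Fin n → 𝕜) : gaussWeight b v ≠ 0 := by
  simp [gaussWeight, Real.exp_pos]

theorem gaussWeight_anti {b c : ℝ} (h : b ≤ c) (v : Fin n → 𝕜) :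
    gaussWeight c v ≤ gaussWeight b v := by
  have : 0 ≤ ∑ j, ‖v j‖ ^ 2 := by positivity
  unfold gaussWeight
  gcongr

theorem gaussWeight_smul_circle (b : ℝ) (c : Circle) (v : Fin n → ℂ) :
    gaussWeight b (fun j => (c : ℂ) * v j) = gaussWeight b v := by
  simp only [gaussWeight, norm_mul, Circle.norm_coe, one_mul]

variable [InnerProductSpace ℝ 𝕜] [FiniteDimensional ℝ 𝕜] [MeasurableSpace 𝕜] [BorelSpace 𝕜]

theorem lintegral_gaussWeight_lt_top {b : ℝ} (hb : 0 < b) :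
    ∫⁻ v : Fin n → 𝕜, gaussWeight b v < ∞ := by
  have h1 : Integrable fun x : 𝕜 => Real.exp (-b * ‖x‖ ^ 2) := by
    have := (GaussianFourier.integrable_cexp_neg_mul_sq_norm_add (V := 𝕜) (b := (b : ℂ))
      (by simpa using hb) 0 0).norm
    refine this.congr (Filter.Eventually.of_forall fun x => ?_)
    simp only [Complex.norm_exp]
    congr 1
    norm_cast
    simp
  have h2 : Integrable fun v : Fin n → 𝕜 => Real.exp (-b * ∑ j, ‖v j‖ ^ 2) := by
    simp_rw [Finset.mul_sum, Real.exp_sum]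
    exact Integrable.fintype_prod fun _ => h1
  exact h2.lintegral_lt_top

theorem lintegral_gaussWeight_ne_zero (b : ℝ) :
    ∫⁻ v : Fin n → 𝕜, gaussWeight b v ≠ 0 := by
  intro h
  rw [lintegral_eq_zero_iff (continuous_gaussWeight b).measurable] at h
  obtain ⟨v, hv⟩ := h.exists
  exact gaussWeight_ne_zero b v hv

end gaussWeight

/-! ### The mean value inequality -/

section meanValue

variable {n : ℕ}

theorem enorm_le_lintegral_circle {h : ℂ → ℂ} (hh : Differentiable ℂ h) :
    ENNReal.ofReal (2 * Real.pi) * ‖h 0‖ₑ ≤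
      ∫⁻ θ in Set.Ioc 0 (2 * Real.pi), ‖h (Circle.exp θ)‖ₑ := by
  have hmean := hh.diffContOnCl.circleAverage (c := 0) (R := 1)
  have hI : ((2 * Real.pi : ℝ) : ℂ) * h 0 = ∫ θ in Set.Ioc 0 (2 * Real.pi), h (Circle.exp θ) := by
    rw [← hmean, Real.circleAverage_def, intervalIntegral.integral_of_le Real.two_pi_pos.le,
      ← Complex.real_smul, smul_inv_smul₀ Real.two_pi_pos.ne']
    simp [circleMap, Circle.coe_exp]
  calc ENNReal.ofReal (2 * Real.pi) * ‖h 0‖ₑ = ‖((2 * Real.pi : ℝ) : ℂ) * h 0‖ₑ := by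
        rw [enorm_mul, ← ofReal_norm ((2 * Real.pi : ℝ) : ℂ), Complex.norm_real,
          Real.norm_of_nonneg Real.two_pi_pos.le]
    _ ≤ _ := hI ▸ enorm_integral_le_lintegral_enorm _

theorem measurePreserving_smul_circle (c : Circle) :
    MeasurePreserving fun (v : Fin n → ℂ) j => (c : ℂ) * v j := by
  have := volume_preserving_pi (ι := Fin n) fun _ => (rotation c).measurePreserving
  simpa only [rotation_apply] using this

/-- The mean value inequality for an entire function `g` on `ℂⁿ` against a circle-invariant weight.
The one-variable mean value property is applied to `λ ↦ g (w + λ ζ)` for each fixed `ζ`; integrating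
over `ζ` removes the rotation, so no iteration over the coordinates is needed. -/
theorem lintegral_mul_enorm_le {g : (Fin n → ℂ) → ℂ} (hg : Differentiable ℂ g)
    {φ : (Fin n → ℂ) → ℝ≥0∞} (hφ : Measurable φ)
    (hrot : ∀ (c : Circle) v, φ (fun j => (c : ℂ) * v j) = φ v) (w : Fin n → ℂ) :
    (∫⁻ ζ, φ ζ) * ‖g w‖ₑ ≤ ∫⁻ ζ, φ ζ * ‖g (w + ζ)‖ₑ := by
  have hgm : Measurable g := hg.continuous.measurable
  have hpos : ENNReal.ofReal (2 * Real.pi) ≠ 0 := by simp [Real.pi_pos]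
  refine (ENNReal.mul_le_mul_iff_right hpos ofReal_ne_top).1 ?_
  calc ENNReal.ofReal (2 * Real.pi) * ((∫⁻ ζ, φ ζ) * ‖g w‖ₑ)
      = ∫⁻ ζ, φ ζ * (ENNReal.ofReal (2 * Real.pi) * ‖g w‖ₑ) := by
        rw [lintegral_mul_const _ hφ]; ring
    _ ≤ ∫⁻ ζ, φ ζ * ∫⁻ θ in Set.Ioc 0 (2 * Real.pi),
          ‖g (w + fun j => (Circle.exp θ : ℂ) * ζ j)‖ₑ := by
        gcongr with ζ
        have hd : Differentiable ℂ fun l : ℂ => g (w + fun j => l * ζ j) :=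
          hg.comp (by fun_prop)
        have := enorm_le_lintegral_circle hd
        simpa [← Pi.zero_def] using this
    _ = ∫⁻ ζ, ∫⁻ θ in Set.Ioc 0 (2 * Real.pi),
          φ ζ * ‖g (w + fun j => (Circle.exp θ : ℂ) * ζ j)‖ₑ := by
        refine lintegral_congr fun ζ => (lintegral_const_mul _ ?_).symm
        fun_prop
    _ = ∫⁻ θ in Set.Ioc 0 (2 * Real.pi), ∫⁻ ζ,
          φ ζ * ‖g (w + fun j => (Circle.exp θ : ℂ) * ζ j)‖ₑ := by
        refine lintegral_lintegral_swap (Measurable.aemeasurable ?_)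
        simp only [Function.uncurry_def]
        fun_prop
    _ = ∫⁻ _θ in Set.Ioc 0 (2 * Real.pi), ∫⁻ ζ, φ ζ * ‖g (w + ζ)‖ₑ := by
        refine lintegral_congr fun θ => ?_
        rw [← (measurePreserving_smul_circle (n := n) (Circle.exp θ)).lintegral_comp
          (f := fun ζ => φ ζ * ‖g (w + ζ)‖ₑ) (by fun_prop)]
        simp only [hrot]
    _ = ENNReal.ofReal (2 * Real.pi) * ∫⁻ ζ, φ ζ * ‖g (w + ζ)‖ₑ := by
        simp [mul_comm]

theorem sum_norm_sub_sq (z w : Fin n → ℂ) :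
    ∑ j, ‖z j - w j‖ ^ 2 =
      ∑ j, ‖z j‖ ^ 2 + ∑ j, ‖w j‖ ^ 2 - 2 * (∑ j, starRingEnd ℂ (w j) * z j).re := by
  rw [Complex.re_sum, Finset.mul_sum, ← Finset.sum_add_distrib, ← Finset.sum_sub_distrib]
  refine Finset.sum_congr rfl fun j _ => ?_
  simp only [Complex.sq_norm, Complex.normSq_apply, Complex.sub_re, Complex.sub_im,
    Complex.mul_re, Complex.conj_re, Complex.conj_im]
  ring

/-- Local control of `|f|² exp(-|·|²)` at a point by its Gaussian mean around that point. -/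
theorem enorm_sq_mul_exp_le {f : (Fin n → ℂ) → ℂ} (hf : Differentiable ℂ f) (w : Fin n → ℂ) :
    (∫⁻ ζ : Fin n → ℂ, gaussWeight 3 ζ) *
        ENNReal.ofReal (‖f w‖ ^ 2 * Real.exp (-∑ j, ‖w j‖ ^ 2)) ≤
      ∫⁻ z, ENNReal.ofReal (‖f z‖ ^ 2 * Real.exp (-∑ j, ‖z j‖ ^ 2)) * gaussWeight 2 (z - w) := by
  -- The entire factor is chosen so that `|g w| = |f w|² exp(-|w|²)` and
  -- `|g z| = |f z|² exp(-|z|²) exp(|z - w|²)`.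
  let g : (Fin n → ℂ) → ℂ := fun z =>
    f z ^ 2 * Complex.exp (((∑ j, ‖w j‖ ^ 2 : ℝ) : ℂ) - 2 * ∑ j, starRingEnd ℂ (w j) * z j)
  have hg : Differentiable ℂ g := by fun_prop
  have hnorm (z : Fin n → ℂ) : ‖g z‖ₑ = ENNReal.ofReal (‖f z‖ ^ 2 *
      Real.exp (∑ j, ‖z j - w j‖ ^ 2 - ∑ j, ‖z j‖ ^ 2)) := by
    rw [← ofReal_norm, norm_mul, norm_pow, Complex.norm_exp, sum_norm_sub_sq]
    congr 3
    simp only [Complex.sub_re, Complex.ofReal_re, Complex.mul_re, Complex.re_ofNat,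
      Complex.im_ofNat]
    ring
  have key := lintegral_mul_enorm_le hg (continuous_gaussWeight 3).measurable
    (gaussWeight_smul_circle 3) w
  have hw : ∑ j, ‖w j - w j‖ ^ 2 - ∑ j, ‖w j‖ ^ 2 = -∑ j, ‖w j‖ ^ 2 := by simp
  rw [hnorm w, hw] at key
  refine key.trans_eq ?_
  rw [← lintegral_add_left_eq_self (fun z => ENNReal.ofReal (‖f z‖ ^ 2 *
    Real.exp (-∑ j, ‖z j‖ ^ 2)) * gaussWeight 2 (z - w)) w]
  refine lintegral_congr fun ζ => ?_
  rw [hnorm, gaussWeight, gaussWeight, ← ENNReal.ofReal_mul (by positivity),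
    ← ENNReal.ofReal_mul (by positivity), mul_assoc, mul_left_comm (Real.exp _), ← Real.exp_add,
    ← Real.exp_add]
  congr 3
  simp only [Pi.add_apply, Pi.sub_apply, add_sub_cancel_left]
  ring

end meanValue

/-! ### Gaussian averages and the Carleson condition -/

section carleson

variable {n : ℕ}

/-- The Gaussian average `∫ exp(-(x - √2 y)²) dϱ(y)` of a positive measure, with values in
`[0, ∞]`; up to a constant it is the spectral function. -/
def gaussAverage (ϱ : Measure (Fin n → ℝ)) (x : Fin n → ℝ) : ℝ≥0∞ :=
  ∫⁻ y, ENNReal.ofReal (Real.exp (-∑ j, (x j - Real.sqrt 2 * y j) ^ 2)) ∂ϱ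

theorem gaussAverage_sqrt_two_smul (ϱ : Measure (Fin n → ℝ)) (x : Fin n → ℝ) :
    gaussAverage ϱ (Real.sqrt 2 • x) = ∫⁻ y, gaussWeight 2 (x - y) ∂ϱ := by
  unfold gaussAverage gaussWeight
  refine lintegral_congr fun y => ?_
  congr 2
  rw [Finset.mul_sum, ← Finset.sum_neg_distrib]
  refine Finset.sum_congr rfl fun j _ => ?_
  rw [Pi.smul_apply, smul_eq_mul, ← mul_sub, mul_pow, Real.sq_sqrt (by norm_num), Pi.sub_apply,
    Real.norm_eq_abs, sq_abs]
  ring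

theorem gaussWeight_sub_ofReal_add_mul_I (b : ℝ) (z : Fin n → ℂ) (x y : Fin n → ℝ) :
    gaussWeight b (z - fun j => (x j : ℂ) + (y j : ℂ) * Complex.I) =
      gaussWeight b ((fun j => (z j).re) - x) * gaussWeight b ((fun j => (z j).im) - y) := by
  rw [gaussWeight, gaussWeight, gaussWeight, ← ENNReal.ofReal_mul (by positivity), ← Real.exp_add,
    ← mul_add, ← Finset.sum_add_distrib]
  congr! 4 with j
  simp [Complex.sq_norm, Complex.normSq_apply]
  ring

theorem lintegral_tensorLebesgue (ϱ : Measure (Fin n → ℝ)) {F : (Fin n → ℂ) → ℝ≥0∞}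
    (hF : Measurable F) :
    ∫⁻ w, F w ∂(tensorLebesgue ϱ) =
      ∫⁻ p : (Fin n → ℝ) × (Fin n → ℝ),
        F (fun j => (p.1 j : ℂ) + (p.2 j : ℂ) * Complex.I) ∂(ϱ.prod volume) :=
  lintegral_map hF (by fun_prop)

/-- Gaussians integrate over `ϱ ⊗ ν_n` to a constant multiple of a Gaussian integral over `ϱ`. -/
theorem lintegral_gaussWeight_sub_tensorLebesgue (ϱ : Measure (Fin n → ℝ)) (b : ℝ)
    (z : Fin n → ℂ) :
    ∫⁻ w, gaussWeight b (z - w) ∂(tensorLebesgue ϱ) =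
      (∫⁻ x, gaussWeight b ((fun j => (z j).re) - x) ∂ϱ) *
        ∫⁻ y : Fin n → ℝ, gaussWeight b y := by
  have hm {𝕜 : Type} [NormedAddCommGroup 𝕜] [MeasurableSpace 𝕜] [BorelSpace 𝕜]
      [SecondCountableTopology 𝕜] (v : Fin n → 𝕜) : Measurable fun u => gaussWeight b (v - u) :=
    ((continuous_gaussWeight b).comp (continuous_const.sub continuous_id)).measurable
  rw [lintegral_tensorLebesgue ϱ (hm z)]
  simp_rw [gaussWeight_sub_ofReal_add_mul_I]
  rw [lintegral_prod_mul (hm _).aemeasurable (hm _).aemeasurable,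
    lintegral_sub_left_eq_self (μ := volume) (gaussWeight b)]

theorem sFinite_tensorLebesgue (ϱ : Measure (Fin n → ℝ)) [SFinite ϱ] :
    SFinite (tensorLebesgue ϱ) := by
  unfold tensorLebesgue
  infer_instance

theorem lintegral_fockGaussian {f : (Fin n → ℂ) → ℂ} (hf : Continuous f) :
    ∫⁻ z, ENNReal.ofReal (‖f z‖ ^ 2) ∂(fockGaussian n) = ENNReal.ofReal (Real.pi ^ n)⁻¹ *
      ∫⁻ z, ENNReal.ofReal (‖f z‖ ^ 2 * Real.exp (-∑ j, ‖z j‖ ^ 2)) := by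
  rw [fockGaussian, lintegral_withDensity_eq_lintegral_mul _ (by fun_prop) (by fun_prop),
    ← lintegral_const_mul _ (by fun_prop)]
  refine lintegral_congr fun z => ?_
  rw [Pi.mul_apply, ← ENNReal.ofReal_mul (by positivity), ← ENNReal.ofReal_mul (by positivity)]
  congr 1
  ring

theorem isFockCarleson_of_gaussAverage_le {ϱ : Measure (Fin n → ℝ)} [SFinite ϱ] {M : ℝ≥0∞}
    (hM : M ≠ ∞) (h : ∀ᵐ x, gaussAverage ϱ x ≤ M) : IsFockCarleson (tensorLebesgue ϱ) := by
  have := sFinite_tensorLebesgue ϱ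
  set A : ℝ≥0∞ := ∫⁻ ζ : Fin n → ℂ, gaussWeight 3 ζ
  have hA0 : A ≠ 0 := lintegral_gaussWeight_ne_zero 3
  have hAtop : A ≠ ∞ := (lintegral_gaussWeight_lt_top (by norm_num)).ne
  set B : ℝ≥0∞ := ∫⁻ y : Fin n → ℝ, gaussWeight 2 y
  have hBtop : B ≠ ∞ := (lintegral_gaussWeight_lt_top (by norm_num)).ne
  set P : ℝ≥0∞ := ENNReal.ofReal (Real.pi ^ n)⁻¹
  have hP0 : P ≠ 0 := by simp [P, Real.pi_pos]
  have hPtop : P ≠ ∞ := ofReal_ne_top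
  -- The exceptional null set in `ℝⁿ` is pulled back to `ℂⁿ` along `z ↦ √2 Re z`.
  have hae : ∀ᵐ z : Fin n → ℂ, gaussAverage ϱ (Real.sqrt 2 • fun j => (z j).re) ≤ M := by
    let L : (Fin n → ℂ) →ₗ[ℝ] (Fin n → ℝ) :=
      Real.sqrt 2 • LinearMap.pi fun j => Complex.reLm ∘ₗ LinearMap.proj j
    have hL : Function.Surjective L := fun x =>
      ⟨fun j => (((Real.sqrt 2)⁻¹ * x j : ℝ) : ℂ), by
        ext j
        simp [L, -Complex.ofReal_mul, -Complex.ofReal_inv]⟩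
    have hmeas : Measurable (gaussAverage ϱ) := by
      unfold gaussAverage
      exact Measurable.lintegral_prod_right' (f := fun p : (Fin n → ℝ) × (Fin n → ℝ) =>
        ENNReal.ofReal (Real.exp (-∑ j, (p.1 j - Real.sqrt 2 * p.2 j) ^ 2))) (by fun_prop)
    exact (ae_comp_linearMap_mem_iff L volume volume hL
      (measurableSet_le hmeas measurable_const)).2 h
  set C : ℝ≥0∞ := M * B / (A * P)
  have hC : C ≠ ∞ := ENNReal.div_ne_top (mul_ne_top hM hBtop) (mul_ne_zero hA0 hP0)
  refine ⟨C.toReal + 1, by positivity, fun f hf => ?_⟩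
  have hfc : Continuous f := hf.1.continuous
  rw [lintegral_fockGaussian hfc]
  set F : (Fin n → ℂ) → ℝ≥0∞ := fun z =>
    ENNReal.ofReal (‖f z‖ ^ 2 * Real.exp (-∑ j, ‖z j‖ ^ 2))
  have hFm : Measurable F := by fun_prop
  have hwm : Measurable (gaussWeight 2 : (Fin n → ℂ) → ℝ≥0∞) :=
    (continuous_gaussWeight 2).measurable
  have key : A * ∫⁻ w, F w ∂(tensorLebesgue ϱ) ≤ M * B * ∫⁻ z, F z := calc
    A * ∫⁻ w, F w ∂(tensorLebesgue ϱ) = ∫⁻ w, A * F w ∂(tensorLebesgue ϱ) :=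
        (lintegral_const_mul _ hFm).symm
    _ ≤ ∫⁻ w, (∫⁻ z, F z * gaussWeight 2 (z - w)) ∂(tensorLebesgue ϱ) :=
        lintegral_mono fun w => enorm_sq_mul_exp_le hf.1 w
    _ = ∫⁻ z, ∫⁻ w, F z * gaussWeight 2 (z - w) ∂(tensorLebesgue ϱ) := by
        refine lintegral_lintegral_swap (Measurable.aemeasurable ?_)
        simp only [Function.uncurry_def]
        fun_prop
    _ = ∫⁻ z, F z * (gaussAverage ϱ (Real.sqrt 2 • fun j => (z j).re) * B) := by
        refine lintegral_congr fun z => ?_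
        rw [lintegral_const_mul _ (by fun_prop), lintegral_gaussWeight_sub_tensorLebesgue,
          gaussAverage_sqrt_two_smul]
    _ ≤ ∫⁻ z, F z * (M * B) := by
        refine lintegral_mono_ae (hae.mono fun z hz => ?_)
        gcongr
    _ = M * B * ∫⁻ z, F z := by rw [lintegral_mul_const _ hFm, mul_comm]
  calc ∫⁻ w, F w ∂(tensorLebesgue ϱ) ≤ (M * B * ∫⁻ z, F z) / A :=
        (ENNReal.le_div_iff_mul_le (.inl hA0) (.inl hAtop)).2 (by rwa [mul_comm])
    _ = C * (P * ∫⁻ z, F z) := by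
        simp only [C, div_eq_mul_inv]
        rw [ENNReal.mul_inv (.inl hA0) (.inl hAtop)]
        calc M * B * (∫⁻ z, F z) * A⁻¹ = M * B * (∫⁻ z, F z) * A⁻¹ * (P⁻¹ * P) := by
              rw [ENNReal.inv_mul_cancel hP0 hPtop, mul_one]
          _ = _ := by ring
    _ ≤ ENNReal.ofReal (C.toReal + 1) * (P * ∫⁻ z, F z) := by
        gcongr
        exact (ENNReal.ofReal_toReal hC).symm.le.trans (ENNReal.ofReal_le_ofReal (by linarith))

/-- The modulus of the reproducing kernel `z ↦ exp(∑ j, a_j z_j)` at a real point `a`. -/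
theorem ofReal_norm_cexp_sq_mul_exp (a : Fin n → ℝ) (z : Fin n → ℂ) :
    ENNReal.ofReal (‖Complex.exp (∑ j, (a j : ℂ) * z j)‖ ^ 2 * Real.exp (-∑ j, ‖z j‖ ^ 2)) =
      ENNReal.ofReal (Real.exp (∑ j, a j ^ 2)) * gaussWeight 1 ((fun j => (a j : ℂ)) - z) := by
  have := sum_norm_sub_sq z fun j => (a j : ℂ)
  simp only [Complex.conj_ofReal, Complex.norm_real, Real.norm_eq_abs, sq_abs] at this
  rw [gaussWeight, ← ENNReal.ofReal_mul (by positivity), Complex.norm_exp, ← Real.exp_nat_mul,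
    ← Real.exp_add, ← Real.exp_add]
  simp only [Pi.sub_apply, norm_sub_rev ((a _ : ℂ)), this]
  congr 2
  push_cast
  ring

theorem exists_gaussAverage_le_of_isFockCarleson {ϱ : Measure (Fin n → ℝ)}
    (h : IsFockCarleson (tensorLebesgue ϱ)) :
    ∃ M : ℝ≥0∞, M ≠ ∞ ∧ ∀ x, gaussAverage ϱ x ≤ M := by
  obtain ⟨ω, -, hω⟩ := h
  set A : ℝ≥0∞ := ∫⁻ ζ : Fin n → ℂ, gaussWeight 1 ζ
  have hAtop : A ≠ ∞ := (lintegral_gaussWeight_lt_top one_pos).ne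
  set B : ℝ≥0∞ := ∫⁻ y : Fin n → ℝ, gaussWeight 1 y
  have hB0 : B ≠ 0 := lintegral_gaussWeight_ne_zero 1
  have hBtop : B ≠ ∞ := (lintegral_gaussWeight_lt_top one_pos).ne
  set P : ℝ≥0∞ := ENNReal.ofReal (Real.pi ^ n)⁻¹
  have hPtop : P ≠ ∞ := ofReal_ne_top
  refine ⟨ENNReal.ofReal ω * (P * A) / B,
    ENNReal.div_ne_top (mul_ne_top ofReal_ne_top (mul_ne_top hPtop hAtop)) hB0, fun x => ?_⟩
  let a : Fin n → ℝ := (Real.sqrt 2)⁻¹ • x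
  have hx : x = Real.sqrt 2 • a := by simp [a]
  set E : ℝ≥0∞ := ENNReal.ofReal (Real.exp (∑ j, a j ^ 2))
  have hE0 : E ≠ 0 := by simp [E, Real.exp_pos]
  have hEtop : E ≠ ∞ := ofReal_ne_top
  let f : (Fin n → ℂ) → ℂ := fun z => Complex.exp (∑ j, (a j : ℂ) * z j)
  have hfd : Differentiable ℂ f := by fun_prop
  have hwm (v : Fin n → ℂ) : Measurable fun z => gaussWeight 1 (v - z) :=
    ((continuous_gaussWeight 1).comp (continuous_const.sub continuous_id)).measurable
  have hnorm : ∫⁻ z, ENNReal.ofReal (‖f z‖ ^ 2) ∂(fockGaussian n) = P * (E * A) := by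
    rw [lintegral_fockGaussian hfd.continuous]
    simp_rw [f, ofReal_norm_cexp_sq_mul_exp]
    rw [lintegral_const_mul _ (hwm _), lintegral_sub_left_eq_self (fun z => gaussWeight 1 z)]
  have hmem : MemFock f := by
    refine ⟨hfd, (memLp_two_iff_integrable_sq_norm
      hfd.continuous.aestronglyMeasurable).2 ⟨by fun_prop, ?_⟩⟩
    rw [hasFiniteIntegral_iff_ofReal (.of_forall fun z => by positivity), hnorm]
    exact (mul_ne_top hPtop (mul_ne_top hEtop hAtop)).lt_top
  have hineq := hω f hmem
  rw [hnorm] at hineq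
  simp_rw [f, ofReal_norm_cexp_sq_mul_exp] at hineq
  rw [lintegral_const_mul _ (hwm _), lintegral_gaussWeight_sub_tensorLebesgue] at hineq
  have hineq' : (∫⁻ y, gaussWeight 1 (a - y) ∂ϱ) * B ≤ ENNReal.ofReal ω * (P * A) := by
    refine (ENNReal.mul_le_mul_iff_right hE0 hEtop).1 (hineq.trans_eq ?_)
    ring
  rw [hx, gaussAverage_sqrt_two_smul, ENNReal.le_div_iff_mul_le (.inl hB0) (.inl hBtop)]
  refine le_trans ?_ hineq'
  gcongr with y
  exact gaussWeight_anti one_le_two _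

end carleson

/-! ### The spectral function -/

namespace ComplexRadonMeasure

variable {n : ℕ}

theorem lintegral_enorm_spectralIntegrand (ϱ : ComplexRadonMeasure n) (x : Fin n → ℝ) :
    ∫⁻ y, ‖ϱ.spectralIntegrand x y‖ₑ ∂ϱ.variation = gaussAverage ϱ.variation x := by
  refine lintegral_congr fun y => ?_
  rw [spectralIntegrand, ← ofReal_norm, norm_mul, ϱ.norm_phase, mul_one,
    Complex.norm_real, Real.norm_of_nonneg (Real.exp_pos _).le]

theorem measurable_spectralIntegrand (ϱ : ComplexRadonMeasure n) :
    Measurable (Function.uncurry ϱ.spectralIntegrand) := by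
  have := ϱ.measurable_phase
  unfold spectralIntegrand
  simp only [Function.uncurry_def]
  fun_prop

theorem spectralMemLinfty_of_gaussAverage_le (ϱ : ComplexRadonMeasure n) {M : ℝ≥0∞} (hM : M ≠ ∞)
    (h : ∀ x, gaussAverage ϱ.variation x ≤ M) : ϱ.SpectralMemLinfty := by
  have := ϱ.regular
  refine ⟨.of_forall fun x => ⟨(ϱ.measurable_spectralIntegrand.comp
    measurable_prodMk_left).aestronglyMeasurable, ?_⟩, ?_⟩
  · rw [hasFiniteIntegral_iff_enorm, lintegral_enorm_spectralIntegrand]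
    exact (h x).trans_lt hM.lt_top
  · have hm : StronglyMeasurable ϱ.spectralFunction :=
      ϱ.measurable_spectralIntegrand.stronglyMeasurable.integral_prod_right.const_mul _
    refine memLp_top_of_bound hm.aestronglyMeasurable
      (|(2 / Real.pi) ^ ((n : ℝ) / 2)| * M.toReal) (.of_forall fun x => ?_)
    rw [spectralFunction, norm_mul, Complex.norm_real, Real.norm_eq_abs]
    gcongr
    rw [← ofReal_le_iff_le_toReal hM, ofReal_norm]
    exact (enorm_integral_le_lintegral_enorm _).trans
      ((ϱ.lintegral_enorm_spectralIntegrand x).trans_le (h x))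

theorem spectralMemLinfty_of_isFockCarleson (ϱ : ComplexRadonMeasure n)
    (h : IsFockCarleson (tensorLebesgue ϱ.variation)) : ϱ.SpectralMemLinfty := by
  obtain ⟨M, hM, hle⟩ := exists_gaussAverage_le_of_isFockCarleson h
  exact ϱ.spectralMemLinfty_of_gaussAverage_le hM hle

theorem isFockCarleson_of_spectralMemLinfty_ofMeasure {ϱ : Measure (Fin n → ℝ)} [ϱ.Regular]
    (h : (ofMeasure ϱ).SpectralMemLinfty) : IsFockCarleson (tensorLebesgue ϱ) := by
  obtain ⟨hint, hbdd⟩ := h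
  set c : ℝ := (2 / Real.pi) ^ ((n : ℝ) / 2)
  have hc0 : 0 < c := by positivity
  set S := eLpNormEssSup (ofMeasure ϱ).spectralFunction volume
  have hS : S ≠ ∞ := by
    have := hbdd.eLpNorm_ne_top
    rwa [eLpNorm_exponent_top] at this
  refine isFockCarleson_of_gaussAverage_le (M := S / ENNReal.ofReal c)
    (ENNReal.div_ne_top hS (by simpa using hc0)) ?_
  filter_upwards [hint, ae_le_eLpNormEssSup (f := (ofMeasure ϱ).spectralFunction)] with x hx hle
  refine (ENNReal.le_div_iff_mul_le (.inl (by simpa using hc0)) (.inl ofReal_ne_top)).2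
    (le_trans (le_of_eq ?_) hle)
  set k : (Fin n → ℝ) → ℝ := fun y => Real.exp (-∑ j, (x j - Real.sqrt 2 * y j) ^ 2)
  have hk : (ofMeasure ϱ).spectralIntegrand x = fun y => (k y : ℂ) := by
    ext y
    simp [spectralIntegrand, ofMeasure, k]
  have hki : Integrable k ϱ := by
    have := hx.re
    simp only [hk, RCLike.re_to_complex, Complex.ofReal_re] at this
    exact this
  have hk0 : 0 ≤ ∫ y, k y ∂ϱ := integral_nonneg fun y => (Real.exp_pos _).le
  have hG : gaussAverage ϱ x = ENNReal.ofReal (∫ y, k y ∂ϱ) :=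
    (ofReal_integral_eq_lintegral_ofReal hki (.of_forall fun y => (Real.exp_pos _).le)).symm
  have hγ : (ofMeasure ϱ).spectralFunction x = ((c * ∫ y, k y ∂ϱ : ℝ) : ℂ) := by
    rw [spectralFunction, hk, Complex.ofReal_mul, ← integral_complex_ofReal]
    rfl
  rw [hγ, hG, ← ofReal_norm, Complex.norm_real, Real.norm_of_nonneg (by positivity),
    ENNReal.ofReal_mul hc0.le, mul_comm]

theorem isFockCarleson_of_variation_lt_top (ϱ : ComplexRadonMeasure n)
    (h : ϱ.variation Set.univ < ∞) : IsFockCarleson (tensorLebesgue ϱ.variation) := by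
  have := ϱ.regular
  refine isFockCarleson_of_gaussAverage_le h.ne (.of_forall fun x => ?_)
  calc gaussAverage ϱ.variation x ≤ ∫⁻ _, 1 ∂ϱ.variation := by
        refine lintegral_mono fun y => ?_
        rw [ofReal_le_one, Real.exp_le_one_iff, neg_nonpos]
        positivity
    _ = ϱ.variation Set.univ := by simp

end ComplexRadonMeasure

end

theorem corollary4p5 (n : ℕ) :
    -- the equivalence for positive regular Borel measures
    (∀ (ϱ : MeasureTheory.Measure (Fin n → ℝ)) [ϱ.Regular],
      (ComplexRadonMeasure.ofMeasure ϱ).SpectralMemLinfty ↔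
        IsFockCarleson (tensorLebesgue ϱ)) ∧
    -- complex measures, where the variation of `ϱ ⊗ ν_n` is `|ϱ| ⊗ ν_n`
    (∀ ϱ : ComplexRadonMeasure n,
      (IsFockCarleson (tensorLebesgue ϱ.variation) → ϱ.SpectralMemLinfty) ∧
      (ϱ.variation Set.univ < ⊤ →
        (ϱ.SpectralMemLinfty ↔ IsFockCarleson (tensorLebesgue ϱ.variation)))) :=
  ⟨fun ϱ _ => ⟨ComplexRadonMeasure.isFockCarleson_of_spectralMemLinfty_ofMeasure,
      (ComplexRadonMeasure.ofMeasure ϱ).spectralMemLinfty_of_isFockCarleson⟩,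
    fun ϱ => ⟨ϱ.spectralMemLinfty_of_isFockCarleson, fun hfin =>
      ⟨fun _ => ϱ.isFockCarleson_of_variation_lt_top hfin,
        ϱ.spectralMemLinfty_of_isFockCarleson⟩⟩⟩
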